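/- Let $N$ be a natural number and let $p$ be a real number with $1<p<N$. Put $p^*=\frac{Np}{N-p}$, $\alpha_{N,p}=N^{\frac1p}\left(\frac{N-p}{p-1}\right)^{\frac{p-1}{p}}$ and $$U(x)=\left(\frac{\alpha_{N,p}}{1+|x|^{\frac p{p-1}}}\right)^{\frac{N-p}{p}},\qquad x\in\mathbb R^N .$$ Let $\mathcal D^{1,2}_*(\mathbb R^N)$ be the completion of the space of those $\phi\in C^1_c(\mathbb R^N)$ for which $$\|\phi\|=\left(\int_{\mathbb R^N}|\nabla U|^{p-2}|\nabla\phi|^2\,dx\right)^{1/2}$$ is finite, with respect to this norm. For $\phi\in\mathcal D^{1,2}_*(\mathbb R^N)$ let $\nabla\phi$ denote the limit in $L^2(\mathbb R^N,|\nabla U|^{p-2}dx;\mathbb R^N)$ of the gradients of an approximating sequence of such $C^1_c$ functions. Then the inclusion of these $C^1_c$ functions into $L^2(\mathbb R^N,U^{p^*-2}dx)$ extends to a continuous injective linear map from $\mathcal D^{1,2}_*(\mathbb R^N)$ into $L^2(\mathbb R^N,U^{p^*-2}dx)$, through which every $\phi\in\mathcal D^{1,2}_*(\mathbb R^N)$ is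 identified with a function, and there is a constant $C>0$, depending only on $N$ and $p$, such that $$\int_{\mathbb R^N}|\nabla U|^{p-2}|\nabla\phi|^2\,dx\;\ge\; C\int_{\mathbb R^N}U^{p^*-2}\phi^2\,dx\qquad\text{for all }\phi\in\mathcal D^{1,2}_*(\mathbb R^N).$$ -/

import Mathlib

open MeasureTheory

noncomputable section

namespace CriticalBubble

/-- The Euclidean space `ℝ^N`. -/
abbrev Space (N : ℕ) : Type := EuclideanSpace ℝ (Fin N)

/-- The normalizing constant `α_{N,p} = N^{1/p} ((N-p)/(p-1))^{(p-1)/p}`. -/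
def alpha (N : ℕ) (p : ℝ) : ℝ :=
  (N : ℝ) ^ (1 / p) * (((N : ℝ) - p) / (p - 1)) ^ ((p - 1) / p)

/-- The bubble `U(x) = (α_{N,p} / (1 + |x|^{p/(p-1)}))^{(N-p)/p}`. -/
def bubble (N : ℕ) (p : ℝ) (x : Space N) : ℝ :=
  (alpha N p / (1 + ‖x‖ ^ (p / (p - 1)))) ^ (((N : ℝ) - p) / p)

/-- The critical Sobolev exponent `p* = Np/(N-p)`. -/
def critExp (N : ℕ) (p : ℝ) : ℝ := (N : ℝ) * p / ((N : ℝ) - p)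

/-- The weight `|∇U|^{p-2}` of the gradient term (for `p < 2` it is singular at the origin; the
value `0` that the real power then takes at this single point is immaterial). -/
def gradWeight (N : ℕ) (p : ℝ) (x : Space N) : ℝ :=
  ‖gradient (bubble N p) x‖ ^ (p - 2)

/-- The weight `U^{p*-2}` of the zero-order term. -/
def massWeight (N : ℕ) (p : ℝ) (x : Space N) : ℝ :=
  bubble N p x ^ (critExp N p - 2)

/-- The measure `|∇U|^{p-2} dx`. -/
def gradMeasure (N : ℕ) (p : ℝ) : Measure (Space N) :=
  (volume : Measure (Space N)).withDensity fun x => ENNReal.ofReal (gradWeight N p x)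

/-- The measure `U^{p*-2} dx`. -/
def massMeasure (N : ℕ) (p : ℝ) : Measure (Space N) :=
  (volume : Measure (Space N)).withDensity fun x => ENNReal.ofReal (massWeight N p x)

lemma gradient_add' {N : ℕ} {f g : Space N → ℝ} (hf : ContDiff ℝ 1 f) (hg : ContDiff ℝ 1 g) :
    gradient (f + g) = gradient f + gradient g := by
  funext x
  simp only [gradient, Pi.add_apply]
  rw [fderiv_add (hf.differentiable one_ne_zero x) (hg.differentiable one_ne_zero x), map_add]

lemma gradient_smul' {N : ℕ} {f : Space N → ℝ} (c : ℝ) (hf : ContDiff ℝ 1 f) :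
    gradient (c • f) = c • gradient f := by
  funext x
  simp only [gradient, Pi.smul_apply]
  rw [fderiv_const_smul (hf.differentiable one_ne_zero x)]
  simp

/-- The functions `φ ∈ C_c^1(ℝ^N)` for which `∫ |∇U|^{p-2} |∇φ|² dx` is finite. (If `p` is so close
to `1` that the weight is not integrable near the origin, the integral is infinite for
some `φ ∈ C_c^1(ℝ^N)`.) -/
def testSubmodule (N : ℕ) (p : ℝ) : Submodule ℝ (Space N → ℝ) where
  carrier := {φ | ContDiff ℝ 1 φ ∧ HasCompactSupport φ ∧
    MemLp (gradient φ) 2 (gradMeasure N p)}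
  add_mem' := by
    rintro f g ⟨hf, hf', hf''⟩ ⟨hg, hg', hg''⟩
    refine ⟨hf.add hg, hf'.add hg', ?_⟩
    rw [gradient_add' hf hg]
    exact hf''.add hg''
  zero_mem' := by
    refine ⟨contDiff_const, HasCompactSupport.zero, ?_⟩
    have h : gradient (0 : Space N → ℝ) = 0 := by
      funext x
      simp [gradient]
    rw [h]
    exact MemLp.zero
  smul_mem' := by
    rintro c f ⟨hf, hf', hf''⟩
    refine ⟨contDiff_const.smul hf, hf'.smul_left (f := fun _ => c), ?_⟩
    rw [gradient_smul' c hf]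
    exact hf''.const_smul c

/-- The vector space of test functions (a type of its own, so that it does not carry the topology
of pointwise convergence). -/
def TestFun (N : ℕ) (p : ℝ) : Type := testSubmodule N p

instance (N : ℕ) (p : ℝ) : AddCommGroup (TestFun N p) :=
  inferInstanceAs (AddCommGroup (testSubmodule N p))

instance (N : ℕ) (p : ℝ) : Module ℝ (TestFun N p) :=
  inferInstanceAs (Module ℝ (testSubmodule N p))

/-- The function underlying a test function. -/
def TestFun.toFun {N : ℕ} {p : ℝ} (φ : TestFun N p) : Space N → ℝ := φ.1

lemma TestFun.contDiff {N : ℕ} {p : ℝ} (φ : TestFun N p) : ContDiff ℝ 1 φ.toFun := φ.2.1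

lemma TestFun.memLp_gradient {N : ℕ} {p : ℝ} (φ : TestFun N p) :
    MemLp (gradient φ.toFun) 2 (gradMeasure N p) := φ.2.2.2

/-- The gradient of a test function, as an element of `L²(|∇U|^{p-2} dx; ℝ^N)`. -/
def gradTest (N : ℕ) (p : ℝ) : TestFun N p →ₗ[ℝ] Lp (Space N) 2 (gradMeasure N p) where
  toFun φ := φ.memLp_gradient.toLp (gradient φ.toFun)
  map_add' φ ψ :=
    (MemLp.toLp_congr _ (φ.memLp_gradient.add ψ.memLp_gradient)
      (Filter.EventuallyEq.of_eq (gradient_add' φ.contDiff ψ.contDiff))).trans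
      (MemLp.toLp_add φ.memLp_gradient ψ.memLp_gradient)
  map_smul' c φ :=
    (MemLp.toLp_congr _ (φ.memLp_gradient.const_smul c)
      (Filter.EventuallyEq.of_eq (gradient_smul' c φ.contDiff))).trans
      (MemLp.toLp_const_smul c φ.memLp_gradient)

/-- The norm `‖φ‖ = (∫ |∇U|^{p-2} |∇φ|² dx)^{1/2}`. -/
instance (N : ℕ) (p : ℝ) : SeminormedAddCommGroup (TestFun N p) :=
  SeminormedAddCommGroup.induced (TestFun N p) (Lp (Space N) 2 (gradMeasure N p)) (gradTest N p)

instance (N : ℕ) (p : ℝ) : NormedSpace ℝ (TestFun N p) :=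
  NormedSpace.induced ℝ (TestFun N p) (Lp (Space N) 2 (gradMeasure N p)) (gradTest N p)

/-- The weighted Sobolev space `D_*^{1,2}(ℝ^N)`: the completion of the test functions with respect
to the norm `(∫ |∇U|^{p-2} |∇φ|² dx)^{1/2}`. -/
abbrev DStar (N : ℕ) (p : ℝ) : Type := UniformSpace.Completion (TestFun N p)

/-- A test function as an element of `D_*^{1,2}(ℝ^N)`. -/
def TestFun.toDStar {N : ℕ} {p : ℝ} (φ : TestFun N p) : DStar N p :=
  (φ : UniformSpace.Completion (TestFun N p))

lemma isometry_gradTest (N : ℕ) (p : ℝ) : Isometry (gradTest N p) :=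
  AddMonoidHomClass.isometry_of_norm (gradTest N p) fun _ => rfl

/-- The gradient of an element of `D_*^{1,2}(ℝ^N)`: the continuous extension of the gradient of
test functions, that is, the limit in `L²(|∇U|^{p-2} dx; ℝ^N)` of the gradients of an
approximating sequence of test functions. -/
def grad {N : ℕ} {p : ℝ} : DStar N p → Lp (Space N) 2 (gradMeasure N p) :=
  UniformSpace.Completion.extension (gradTest N p)

lemma grad_toDStar {N : ℕ} {p : ℝ} (φ : TestFun N p) : grad φ.toDStar = gradTest N p φ :=
  UniformSpace.Completion.extension_coe (isometry_gradTest N p).uniformContinuous φ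

lemma norm_grad {N : ℕ} {p : ℝ} (Φ : DStar N p) : ‖grad Φ‖ = ‖Φ‖ := by
  induction Φ using UniformSpace.Completion.induction_on with
  | hp =>
    exact isClosed_eq (UniformSpace.Completion.continuous_extension.norm) continuous_norm
  | ih φ =>
    rw [UniformSpace.Completion.norm_coe]
    exact congrArg norm (grad_toDStar φ)

end CriticalBubble

end

/-! Write B = 1 + |x|^{p/(p-1)}, b = N(p-2)/p and l = (N-p)/(p-1). Up to constants the two weights
are B^{-b}|x|^{(p-2)/(p-1)} and B^{-b-2}. For a test function φ the field B^{-b-1} φ² x has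
divergence of integral zero. The divergence equals B^{-b-2}((N + l s) φ² + 2 B φ x·∇φ) with s =
|x|^{p/(p-1)}. The term l s φ² absorbs the cross term by completing the square, and N B^{-b-2} φ² is
left over. This gives the inequality with the explicit constant `hardyConst` (`pointwise_hardy`,
`hardy`), which passes to the completion by density.

Injectivity: the gradient of Φ is the weak gradient of its image away from the origin
(`inner_grad_eq`), because dividing by the weights turns unweighted pairings into weighted L² inner
products, which survive limits. If the image is zero, then the gradient vanishes a.e. off the
origin, a null set. Since the norm of Φ is that of its gradient, Φ = 0. -/

noncomputable section

namespace CriticalBubble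

/-! ### Explicit formulas for the bubble and the weights. -/

variable {N : ℕ} {p : ℝ}

/-- The radial function `1 + |x|^{p/(p-1)}`. -/
def base (p : ℝ) {N : ℕ} (x : Space N) : ℝ := 1 + ‖x‖ ^ (p / (p - 1))

lemma base_pos (p : ℝ) (x : Space N) : 0 < base p x := by
  unfold base
  positivity

lemma one_lt_conj (hp : 1 < p) : 1 < p / (p - 1) := by
  rw [lt_div_iff₀ (by linarith)]
  linarith

lemma contDiff_base (hp : 1 < p) : ContDiff ℝ 1 (base p : Space N → ℝ) :=
  contDiff_const.add (contDiff_norm_rpow (one_lt_conj hp))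

lemma contDiff_base_rpow (hp : 1 < p) (t : ℝ) :
    ContDiff ℝ 1 (fun x : Space N => base p x ^ t) :=
  (contDiff_base hp).rpow_const_of_ne fun x => (base_pos p x).ne'

lemma continuous_base_rpow (hp : 1 < p) (t : ℝ) :
    Continuous (fun x : Space N => base p x ^ t) :=
  (contDiff_base_rpow hp t).continuous

lemma hasFDerivAt_base_rpow (hp : 1 < p) (t : ℝ) (x : Space N) :
    HasFDerivAt (fun x : Space N => base p x ^ t)
      ((t * base p x ^ (t - 1) * (p / (p - 1) * ‖x‖ ^ (p / (p - 1) - 2))) • innerSL ℝ x) x := by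
  have h : HasFDerivAt (base p : Space N → ℝ)
      ((p / (p - 1) * ‖x‖ ^ (p / (p - 1) - 2)) • innerSL ℝ x) x :=
    (hasFDerivAt_norm_rpow x (one_lt_conj hp)).const_add 1
  rw [← smul_smul]
  exact h.rpow_const (Or.inl (base_pos p x).ne')

lemma fderiv_base_rpow_self (hp : 1 < p) (t : ℝ) (x : Space N) :
    fderiv ℝ (fun x : Space N => base p x ^ t) x x =
      t * (p / (p - 1)) * base p x ^ (t - 1) * ‖x‖ ^ (p / (p - 1)) := by
  rw [(hasFDerivAt_base_rpow hp t x).fderiv]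
  have hq := one_lt_conj hp
  rcases eq_or_ne x 0 with rfl | hx
  · rw [map_zero, norm_zero, Real.zero_rpow (by linarith)]
    simp
  · have hn : 0 < ‖x‖ := norm_pos_iff.2 hx
    have h : ‖x‖ ^ (p / (p - 1)) = ‖x‖ ^ (p / (p - 1) - 2) * ‖x‖ ^ 2 := by
      rw [← Real.rpow_natCast, ← Real.rpow_add hn]
      norm_num
    simp only [FunLike.coe_smul, Pi.smul_apply, innerSL_apply_apply,
      real_inner_self_eq_norm_sq, smul_eq_mul, h]
    ring

lemma alpha_pos (hp : 1 < p) (hpN : p < N) : 0 < alpha N p := by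
  have : (0 : ℝ) < N := by linarith
  have h2 : 0 < ((N : ℝ) - p) / (p - 1) := div_pos (by linarith) (by linarith)
  unfold alpha
  positivity

lemma bubble_eq (hp : 1 < p) (hpN : p < N) (x : Space N) :
    bubble N p x = alpha N p ^ (((N : ℝ) - p) / p) * base p x ^ (-(((N : ℝ) - p) / p)) := by
  rw [bubble, ← base, Real.div_rpow (alpha_pos hp hpN).le (base_pos p x).le,
    Real.rpow_neg (base_pos p x).le, div_eq_mul_inv]

lemma bubble_pos (hp : 1 < p) (hpN : p < N) (x : Space N) : 0 < bubble N p x := by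
  rw [bubble_eq hp hpN]
  exact mul_pos (Real.rpow_pos_of_pos (alpha_pos hp hpN) _) (Real.rpow_pos_of_pos (base_pos p x) _)

/-- The constant factor of `|∇U|`. -/
def gradConst (N : ℕ) (p : ℝ) : ℝ :=
  alpha N p ^ (((N : ℝ) - p) / p) * (((N : ℝ) - p) / p) * (p / (p - 1))

lemma gradConst_pos (hp : 1 < p) (hpN : p < N) : 0 < gradConst N p := by
  have h1 := alpha_pos hp hpN
  have h2 : 0 < ((N : ℝ) - p) / p := div_pos (by linarith) (by linarith)
  have h3 : 0 < p / (p - 1) := div_pos (by linarith) (by linarith)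
  unfold gradConst
  positivity

lemma norm_gradient {f : Space N → ℝ} (x : Space N) : ‖gradient f x‖ = ‖fderiv ℝ f x‖ := by
  simp [gradient]

lemma norm_gradient_bubble (hp : 1 < p) (hpN : p < N) (x : Space N) :
    ‖gradient (bubble N p) x‖ =
      gradConst N p * (base p x ^ (-((N : ℝ) / p)) * ‖x‖ ^ (1 / (p - 1))) := by
  have hp1 : p - 1 ≠ 0 := by linarith
  have hp0 : p ≠ 0 := by linarith
  have hk : 0 < ((N : ℝ) - p) / p := div_pos (by linarith) (by linarith)
  have hq : 0 < p / (p - 1) := div_pos (by linarith) (by linarith)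
  have hf : bubble N p = fun x =>
      alpha N p ^ (((N : ℝ) - p) / p) * base p x ^ (-(((N : ℝ) - p) / p)) :=
    funext (bubble_eq hp hpN)
  have ha : 0 < alpha N p ^ (((N : ℝ) - p) / p) := Real.rpow_pos_of_pos (alpha_pos hp hpN) _
  have hb : 0 < base p x ^ (-(((N : ℝ) - p) / p) - 1) := Real.rpow_pos_of_pos (base_pos p x) _
  -- At the origin the factor ‖x‖ annihilates whatever value the possibly negative power takes
  -- there.
  have hx2 : ‖x‖ ^ (p / (p - 1) - 2) * ‖x‖ = ‖x‖ ^ (1 / (p - 1)) := by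
    have h1 : 0 < 1 / (p - 1) := div_pos one_pos (by linarith)
    rcases eq_or_ne x 0 with rfl | hx
    · rw [norm_zero, Real.zero_rpow h1.ne', mul_zero]
    · rw [← Real.rpow_add_one (norm_ne_zero_iff.2 hx)]
      congr 1
      field_simp
      ring
  have hexp : -(((N : ℝ) - p) / p) - 1 = -((N : ℝ) / p) := by
    field_simp
    ring
  rw [norm_gradient, hf, ((hasFDerivAt_base_rpow hp _ x).const_mul _).fderiv, norm_smul, norm_smul,
    innerSL_apply_norm, norm_mul, norm_mul, norm_neg, norm_mul, Real.norm_of_nonneg ha.le,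
    Real.norm_of_nonneg hk.le, Real.norm_of_nonneg hb.le, Real.norm_of_nonneg hq.le,
    Real.norm_of_nonneg (by positivity : (0:ℝ) ≤ ‖x‖ ^ (p / (p - 1) - 2)), ← hx2, hexp, gradConst]
  ring

lemma gradWeight_eq (hp : 1 < p) (hpN : p < N) (x : Space N) :
    gradWeight N p x = gradConst N p ^ (p - 2) *
      (base p x ^ (-((N : ℝ) * (p - 2) / p)) * ‖x‖ ^ ((p - 2) / (p - 1))) := by
  have hb := base_pos p x
  rw [gradWeight, norm_gradient_bubble hp hpN, Real.mul_rpow (gradConst_pos hp hpN).le (by positivity),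
    Real.mul_rpow (by positivity) (by positivity), ← Real.rpow_mul hb.le,
    ← Real.rpow_mul (norm_nonneg x)]
  congr 3 <;> ring_nf

lemma gradWeight_pos (hp : 1 < p) (hpN : p < N) {x : Space N} (hx : x ≠ 0) :
    0 < gradWeight N p x := by
  have h1 := gradConst_pos hp hpN
  have h2 := base_pos p x
  have h3 : 0 < ‖x‖ := norm_pos_iff.2 hx
  rw [gradWeight_eq hp hpN]
  positivity

lemma gradWeight_nonneg (x : Space N) : 0 ≤ gradWeight N p x := by
  unfold gradWeight
  positivity

lemma measurable_gradWeight (hp : 1 < p) (hpN : p < N) : Measurable (gradWeight N p) := by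
  rw [funext (gradWeight_eq hp hpN)]
  exact (((continuous_base_rpow hp _).measurable).mul (measurable_norm.pow_const _)).const_mul _

lemma continuousAt_gradWeight (hp : 1 < p) (hpN : p < N) {x : Space N} (hx : x ≠ 0) :
    ContinuousAt (gradWeight N p) x := by
  rw [funext (gradWeight_eq hp hpN)]
  exact continuousAt_const.mul ((continuous_base_rpow hp _).continuousAt.mul
    (continuous_norm.continuousAt.rpow_const (Or.inl (norm_ne_zero_iff.2 hx))))

/-- The constant factor of `U^{p*-2}`. -/
def massConst (N : ℕ) (p : ℝ) : ℝ := alpha N p ^ ((((N : ℝ) - p) / p) * (critExp N p - 2))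

lemma massConst_pos (hp : 1 < p) (hpN : p < N) : 0 < massConst N p :=
  Real.rpow_pos_of_pos (alpha_pos hp hpN) _

/-- Since p*(N-p)/p = N, the exponent is -(N - 2(N-p)/p) = -b - 2: exactly two powers of B below the
gradient weight, which leaves B^{-b-1} as the intermediate choice for the Hardy field. -/
lemma massWeight_eq (hp : 1 < p) (hpN : p < N) (x : Space N) :
    massWeight N p x = massConst N p * base p x ^ (-((N : ℝ) * (p - 2) / p) - 2) := by
  have hb := base_pos p x
  have ha := alpha_pos hp hpN
  rw [massWeight, bubble_eq hp hpN, Real.mul_rpow (by positivity) (by positivity),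
    ← Real.rpow_mul hb.le, ← Real.rpow_mul ha.le, massConst]
  congr 2
  have h1 : (N : ℝ) - p ≠ 0 := by linarith
  have h2 : p ≠ 0 := by linarith
  unfold critExp
  field_simp
  ring

lemma massWeight_pos (hp : 1 < p) (hpN : p < N) (x : Space N) : 0 < massWeight N p x :=
  Real.rpow_pos_of_pos (bubble_pos hp hpN x) _

lemma continuous_massWeight (hp : 1 < p) (hpN : p < N) : Continuous (massWeight N p) := by
  rw [funext (massWeight_eq hp hpN)]
  exact continuous_const.mul (continuous_base_rpow hp _)

/-! ### The weighted Hardy inequality. -/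

/-- The divergence theorem for the field `h(x) x`. -/
lemma integral_fderiv_self {h : Space N → ℝ} (hh : ContDiff ℝ 1 h) (hc : HasCompactSupport h) :
    ∫ x, fderiv ℝ h x x = -(N : ℝ) * ∫ x, h x := by
  have hd : Continuous (fderiv ℝ h) := hh.continuous_fderiv one_ne_zero
  have hdc : HasCompactSupport (fderiv ℝ h) := hc.fderiv ℝ
  have hint (i : Fin N) :
      Integrable fun x : Space N => x i * fderiv ℝ h x (EuclideanSpace.single i 1) := by
    refine Continuous.integrable_of_hasCompactSupport (by fun_prop) ?_
    refine hdc.mono' fun x hx => subset_tsupport _ ?_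
    contrapose! hx
    simp [Function.notMem_support.1 hx]
  have key (i : Fin N) :
      ∫ x : Space N, x i * fderiv ℝ h x (EuclideanSpace.single i 1) = -∫ x, h x := by
    have hf (x : Space N) : fderiv ℝ (fun y : Space N => y i) x (EuclideanSpace.single i 1) = 1 := by
      have : HasFDerivAt (fun y : Space N => y i)
        (EuclideanSpace.proj i : Space N →L[ℝ] ℝ) x :=
        (EuclideanSpace.proj i : Space N →L[ℝ] ℝ).hasFDerivAt
      rw [this.fderiv]
      simp
    have := integral_mul_fderiv_eq_neg_fderiv_mul_of_integrable (μ := (volume : Measure (Space N)))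
      (f := fun y : Space N => y i) (g := h) (v := EuclideanSpace.single i 1) ?_ (hint i) ?_ ?_ ?_
    · simpa [hf] using this
    · simp only [hf, one_mul]
      exact hh.continuous.integrable_of_hasCompactSupport hc
    · refine Continuous.integrable_of_hasCompactSupport ?_ hc.mul_left
      exact (EuclideanSpace.proj i : Space N →L[ℝ] ℝ).continuous.mul hh.continuous
    · exact fun x _ => (EuclideanSpace.proj i : Space N →L[ℝ] ℝ).differentiableAt
    · exact fun x _ => hh.differentiable one_ne_zero x
  have hsum (x : Space N) :
      fderiv ℝ h x x = ∑ i, x i * fderiv ℝ h x (EuclideanSpace.single i 1) := by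
    have := congrArg (fderiv ℝ h x) ((EuclideanSpace.basisFun (Fin N) ℝ).sum_repr x)
    simpa [map_sum] using this.symm
  simp_rw [hsum]
  rw [integral_finsetSum _ fun i _ => hint i]
  simp [key]

lemma decay_pos (hp : 1 < p) (hpN : p < N) : 0 < ((N : ℝ) - p) / (p - 1) :=
  div_pos (by linarith) (by linarith)

/-- The right-hand side is the divergence of B^{-b-1} φ² x, so it integrates to zero. After
expansion the difference of the two sides is B^{-b-2} times the nonnegative quantity in `hsq`. -/
lemma pointwise_hardy (hp : 1 < p) (hpN : p < N) {φ : Space N → ℝ} (hφ : ContDiff ℝ 1 φ)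
    {x : Space N} (hx : x ≠ 0) :
    N * (base p x ^ (-((N : ℝ) * (p - 2) / p) - 2) * φ x ^ 2) -
      (((N : ℝ) - p) / (p - 1))⁻¹ * (base p x ^ (-((N : ℝ) * (p - 2) / p)) *
        ‖x‖ ^ ((p - 2) / (p - 1)) * ‖gradient φ x‖ ^ 2) ≤
    N * (base p x ^ (-((N : ℝ) * (p - 2) / p) - 1) * φ x ^ 2) +
      fderiv ℝ (fun x => base p x ^ (-((N : ℝ) * (p - 2) / p) - 1) * φ x ^ 2) x x := by
  have hl := decay_pos hp hpN
  have hn : 0 < ‖x‖ := norm_pos_iff.2 hx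
  have hB := base_pos p x
  set b : ℝ := (N : ℝ) * (p - 2) / p with hb
  set l : ℝ := ((N : ℝ) - p) / (p - 1) with hl'
  have hderiv : fderiv ℝ (fun x => base p x ^ (-b - 1) * φ x ^ 2) x x =
      (-b - 1) * (p / (p - 1)) * base p x ^ (-b - 2) * ‖x‖ ^ (p / (p - 1)) * φ x ^ 2 +
        2 * base p x ^ (-b - 1) * φ x * fderiv ℝ φ x x := by
    have h1 := (contDiff_base_rpow (N := N) hp (-b - 1)).differentiable one_ne_zero x
    have h2 := hφ.differentiable one_ne_zero x
    have h3 := fderiv_base_rpow_self hp (-b - 1) x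
    rw [show (-b - 1 - 1 : ℝ) = -b - 2 by ring] at h3
    rw [fderiv_fun_mul h1 (h2.fun_pow 2), fderiv_fun_pow 2 h2]
    simp only [FunLike.coe_add, Pi.add_apply, FunLike.coe_smul, Pi.smul_apply, smul_eq_mul, h3]
    simp
    ring
  have hD : |fderiv ℝ φ x x| ≤ ‖gradient φ x‖ * ‖x‖ := by
    rw [norm_gradient]
    exact (fderiv ℝ φ x).le_opNorm x
  -- With B = 1 + s this gives N B + (l - N) s = N + l s: the N is the Hardy term, and l s pays for
  -- the cross term.
  have hlam : (-b - 1) * (p / (p - 1)) = l - N := by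
    have h1 : p - 1 ≠ 0 := by linarith
    have h2 : p ≠ 0 := by linarith
    rw [hb, hl']
    field_simp
    ring
  have hs : base p x = 1 + ‖x‖ ^ (p / (p - 1)) := rfl
  set s := ‖x‖ ^ (p / (p - 1)) with hs'
  set r := ‖x‖ ^ ((p - 2) / (p - 1)) with hr
  have hsr : s * r = ‖x‖ ^ 2 := by
    rw [hs', hr, ← Real.rpow_add hn, ← Real.rpow_natCast]
    congr 1
    have h1 : p - 1 ≠ 0 := by linarith
    push_cast
    field_simp
    ring
  have hr0 : 0 < r := Real.rpow_pos_of_pos hn _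
  have hs0 : 0 < s := Real.rpow_pos_of_pos hn _
  have hT0 : 0 < base p x ^ (-b - 2) := Real.rpow_pos_of_pos hB _
  have hT1 : base p x ^ (-b - 1) = base p x ^ (-b - 2) * base p x := by
    rw [← Real.rpow_add_one hB.ne']
    ring_nf
  have hT2 : base p x ^ (-b) = base p x ^ (-b - 2) * base p x ^ 2 := by
    rw [← Real.rpow_natCast, ← Real.rpow_add hB]
    push_cast
    ring_nf
  rw [hderiv, hlam, hT1, hT2]
  set T := base p x ^ (-b - 2)
  set B := base p x
  set G := ‖gradient φ x‖
  set D := fderiv ℝ φ x x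
  have hD2 : D ^ 2 ≤ G ^ 2 * (s * r) := by
    rw [hsr, ← mul_pow]
    exact sq_le_sq' (by linarith [neg_abs_le D]) (le_trans (le_abs_self D) hD)
  -- Complete the square in φ, then use D² ≤ |∇φ|²|x|² with |x|² = s r, so that the 1/s produced by
  -- the square cancels.
  have hsq : 0 ≤ l * s * φ x ^ 2 + 2 * B * φ x * D + l⁻¹ * (B ^ 2 * r * G ^ 2) := by
    have h1 : 0 ≤ (l * s)⁻¹ * (l * s * φ x + B * D) ^ 2 := by positivity
    have h2 : (l * s)⁻¹ * (l * s * φ x + B * D) ^ 2 =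
        l * s * φ x ^ 2 + 2 * B * φ x * D + l⁻¹ * (B ^ 2 * (D ^ 2 / s)) := by
      field_simp
      ring
    have h3 : D ^ 2 / s ≤ r * G ^ 2 := by
      rw [div_le_iff₀ hs0]
      linarith
    have h4 : l⁻¹ * (B ^ 2 * (D ^ 2 / s)) ≤ l⁻¹ * (B ^ 2 * (r * G ^ 2)) := by gcongr
    linarith
  have := mul_nonneg hT0.le hsq
  rw [hs]
  rw [hs] at this
  linarith

lemma ae_ne_zero (hp : 1 < p) (hpN : p < N) : ∀ᵐ x : Space N, x ≠ 0 := by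
  -- In dimension zero the origin would be the whole space; 1 < p < N excludes this.
  have : Nonempty (Fin N) := by
    refine ⟨⟨0, ?_⟩⟩
    have : (0 : ℝ) < N := by linarith
    exact_mod_cast this
  simp [ae_iff]

/-- A weighted Hardy inequality for `C^1` functions of compact support. -/
lemma hardy (hp : 1 < p) (hpN : p < N) {φ : Space N → ℝ} (hφ : ContDiff ℝ 1 φ)
    (hc : HasCompactSupport φ) (hi : Integrable fun x => base p x ^ (-((N : ℝ) * (p - 2) / p)) *
        ‖x‖ ^ ((p - 2) / (p - 1)) * ‖gradient φ x‖ ^ 2) :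
    N * ∫ x, base p x ^ (-((N : ℝ) * (p - 2) / p) - 2) * φ x ^ 2 ≤
      (((N : ℝ) - p) / (p - 1))⁻¹ * ∫ x, base p x ^ (-((N : ℝ) * (p - 2) / p)) *
        ‖x‖ ^ ((p - 2) / (p - 1)) * ‖gradient φ x‖ ^ 2 := by
  have hc2 : HasCompactSupport fun x => φ x ^ 2 := hc.comp_left (g := fun t => t ^ 2) (by simp)
  have hint (t : ℝ) : Integrable fun x => base p x ^ t * φ x ^ 2 :=
    ((continuous_base_rpow hp t).mul (hφ.continuous.pow 2)).integrable_of_hasCompactSupport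
      hc2.mul_left
  have hh : ContDiff ℝ 1 fun x => base p x ^ (-((N : ℝ) * (p - 2) / p) - 1) * φ x ^ 2 :=
    (contDiff_base_rpow hp _).mul (hφ.pow 2)
  have hhc : HasCompactSupport fun x => base p x ^ (-((N : ℝ) * (p - 2) / p) - 1) * φ x ^ 2 :=
    hc2.mul_left
  have hdint : Integrable fun x =>
      fderiv ℝ (fun x => base p x ^ (-((N : ℝ) * (p - 2) / p) - 1) * φ x ^ 2) x x := by
    have hd := hh.continuous_fderiv one_ne_zero
    refine Continuous.integrable_of_hasCompactSupport (by fun_prop) ?_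
    refine (hhc.fderiv ℝ).mono' fun x hx => subset_tsupport _ ?_
    contrapose! hx
    simp [Function.notMem_support.1 hx]
  have key := integral_mono_ae (((hint _).const_mul _).sub (hi.const_mul _))
    (((hint _).const_mul _).add hdint) ((ae_ne_zero hp hpN).mono fun x hx => pointwise_hardy hp hpN hφ hx)
  simp only [Pi.add_apply, Pi.sub_apply] at key
  rw [integral_sub ((hint _).const_mul _) (hi.const_mul _),
    integral_add ((hint _).const_mul _) hdint, integral_const_mul, integral_const_mul,
    integral_const_mul, integral_fderiv_self hh hhc] at key
  linarith

/-! ### L² spaces with a density. -/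

section WeightedL2

variable {X E : Type*} [MeasurableSpace X] {μ : Measure X} [NormedAddCommGroup E]
  {w : X → ℝ}

lemma integral_withDensity_ofReal [NormedSpace ℝ E] (hw : Measurable w) (hw0 : ∀ x, 0 ≤ w x)
    (f : X → E) : ∫ x, f x ∂(μ.withDensity fun x => ENNReal.ofReal (w x)) = ∫ x, w x • f x ∂μ := by
  rw [integral_withDensity_eq_integral_toReal_smul hw.ennreal_ofReal (by simp)]
  simp [hw0]

lemma integrable_withDensity_ofReal [NormedSpace ℝ E] (hw : Measurable w) (hw0 : ∀ x, 0 ≤ w x)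
    {f : X → E} : Integrable f (μ.withDensity fun x => ENNReal.ofReal (w x)) ↔
      Integrable (fun x => w x • f x) μ := by
  rw [integrable_withDensity_iff_integrable_smul' hw.ennreal_ofReal (by simp)]
  simp [hw0]

lemma integrable_weight_mul_norm_sq (hw : Measurable w) (hw0 : ∀ x, 0 ≤ w x)
    {f : X → E} (hf : MemLp f 2 (μ.withDensity fun x => ENNReal.ofReal (w x))) :
    Integrable (fun x => w x * ‖f x‖ ^ 2) μ :=
  (integrable_withDensity_ofReal hw hw0).1 ((memLp_two_iff_integrable_sq_norm hf.1).1 hf)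

lemma norm_sq_eq_integral_weight [InnerProductSpace ℝ E] (hw : Measurable w) (hw0 : ∀ x, 0 ≤ w x)
    (f : Lp E 2 (μ.withDensity fun x => ENNReal.ofReal (w x))) :
    ‖f‖ ^ 2 = ∫ x, w x * ‖f x‖ ^ 2 ∂μ := by
  rw [← real_inner_self_eq_norm_sq, L2.inner_def, integral_withDensity_ofReal hw hw0]
  simp

lemma norm_toLp_sq [InnerProductSpace ℝ E] (hw : Measurable w) (hw0 : ∀ x, 0 ≤ w x)
    {f : X → E} (hf : MemLp f 2 (μ.withDensity fun x => ENNReal.ofReal (w x))) :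
    ‖hf.toLp f‖ ^ 2 = ∫ x, w x * ‖f x‖ ^ 2 ∂μ := by
  rw [norm_sq_eq_integral_weight hw hw0]
  simp_rw [← smul_eq_mul]
  rw [← integral_withDensity_ofReal hw hw0, ← integral_withDensity_ofReal hw hw0]
  refine integral_congr_ae ?_
  filter_upwards [hf.coeFn_toLp] with x hx
  rw [hx]

lemma ofReal_norm_sq_eq_lintegral [InnerProductSpace ℝ E] (hw : Measurable w)
    (hw0 : ∀ x, 0 ≤ w x) (f : Lp E 2 (μ.withDensity fun x => ENNReal.ofReal (w x))) :
    ENNReal.ofReal (‖f‖ ^ 2) = ∫⁻ x, ENNReal.ofReal (w x * ‖f x‖ ^ 2) ∂μ := by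
  rw [norm_sq_eq_integral_weight hw hw0, ofReal_integral_eq_lintegral_ofReal
    (integrable_weight_mul_norm_sq hw hw0 (Lp.memLp f))]
  exact ae_of_all _ fun x => mul_nonneg (hw0 x) (sq_nonneg _)

end WeightedL2

/-! ### The embedding into the weighted L² space. -/

lemma TestFun.hasCompactSupport (φ : TestFun N p) : HasCompactSupport φ.toFun := φ.2.2.1

/-- The constant in the weighted Hardy inequality. -/
def hardyConst (N : ℕ) (p : ℝ) : ℝ :=
  N * (((N : ℝ) - p) / (p - 1)) * gradConst N p ^ (p - 2) / massConst N p

lemma hardyConst_pos (hp : 1 < p) (hpN : p < N) : 0 < hardyConst N p := by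
  have h1 := decay_pos hp hpN
  have h2 := gradConst_pos hp hpN
  have h3 := massConst_pos hp hpN
  have h4 : (0 : ℝ) < N := by linarith
  unfold hardyConst
  positivity

lemma hardy_weight (hp : 1 < p) (hpN : p < N) (φ : TestFun N p) :
    hardyConst N p * ∫ x, massWeight N p x * φ.toFun x ^ 2 ≤
      ∫ x, gradWeight N p x * ‖gradient φ.toFun x‖ ^ 2 := by
  have hA : 0 < gradConst N p ^ (p - 2) := Real.rpow_pos_of_pos (gradConst_pos hp hpN) _
  have hm := massConst_pos hp hpN
  have hl := decay_pos hp hpN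
  have hint := integrable_weight_mul_norm_sq (measurable_gradWeight hp hpN) gradWeight_nonneg
    φ.memLp_gradient
  simp only [gradWeight_eq hp hpN, mul_assoc (gradConst N p ^ (p - 2))] at hint
  have h := hardy hp hpN φ.contDiff φ.hasCompactSupport
    (((integrable_const_mul_iff (IsUnit.mk0 _ hA.ne') _).1 hint))
  simp only [gradWeight_eq hp hpN, massWeight_eq hp hpN, mul_assoc (gradConst N p ^ (p - 2)),
    mul_assoc (massConst N p)]
  rw [integral_const_mul, integral_const_mul, hardyConst]
  rw [inv_mul_eq_div, le_div_iff₀ hl] at h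
  calc _ = gradConst N p ^ (p - 2) * ((N * ∫ x, base p x ^ (-((N : ℝ) * (p - 2) / p) - 2) *
          φ.toFun x ^ 2) * (((N : ℝ) - p) / (p - 1))) := by
        field_simp
    _ ≤ _ := by gcongr

lemma isLocallyFiniteMeasure_massMeasure (hp : 1 < p) (hpN : p < N) :
    IsLocallyFiniteMeasure (massMeasure N p) :=
  IsLocallyFiniteMeasure.withDensity_ofReal (continuous_massWeight hp hpN)

lemma memLp_massMeasure (hp : 1 < p) (hpN : p < N) {f : Space N → ℝ} (hf : Continuous f)
    (hc : HasCompactSupport f) : MemLp f 2 (massMeasure N p) := by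
  have := isLocallyFiniteMeasure_massMeasure hp hpN
  exact hf.memLp_of_hasCompactSupport hc

/-- The inclusion of the test functions into `L²(U^{p*-2} dx)`. -/
def massTest (hp : 1 < p) (hpN : p < N) : TestFun N p →ₗ[ℝ] Lp ℝ 2 (massMeasure N p) where
  toFun φ := (memLp_massMeasure hp hpN φ.contDiff.continuous φ.hasCompactSupport).toLp φ.toFun
  map_add' φ ψ := MemLp.toLp_add
    (memLp_massMeasure hp hpN φ.contDiff.continuous φ.hasCompactSupport)
    (memLp_massMeasure hp hpN ψ.contDiff.continuous ψ.hasCompactSupport)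
  map_smul' c φ := MemLp.toLp_const_smul c
    (memLp_massMeasure hp hpN φ.contDiff.continuous φ.hasCompactSupport)

lemma coeFn_massTest (hp : 1 < p) (hpN : p < N) (φ : TestFun N p) :
    massTest hp hpN φ =ᵐ[massMeasure N p] φ.toFun :=
  MemLp.coeFn_toLp
    (memLp_massMeasure hp hpN φ.contDiff.continuous φ.hasCompactSupport)

lemma norm_massTest_le (hp : 1 < p) (hpN : p < N) (φ : TestFun N p) :
    hardyConst N p * ‖massTest hp hpN φ‖ ^ 2 ≤ ‖φ‖ ^ 2 := by
  have h1 : ‖massTest hp hpN φ‖ ^ 2 = ∫ x, massWeight N p x * ‖φ.toFun x‖ ^ 2 :=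
    norm_toLp_sq (continuous_massWeight hp hpN).measurable
      (fun x => (massWeight_pos hp hpN x).le)
      (memLp_massMeasure hp hpN φ.contDiff.continuous φ.hasCompactSupport)
  have h2 : ‖φ‖ ^ 2 = ∫ x, gradWeight N p x * ‖gradient φ.toFun x‖ ^ 2 :=
    norm_toLp_sq (measurable_gradWeight hp hpN) gradWeight_nonneg φ.memLp_gradient
  rw [h1, h2]
  simpa using hardy_weight hp hpN φ

lemma norm_massTest_le' (hp : 1 < p) (hpN : p < N) (φ : TestFun N p) :
    ‖massTest hp hpN φ‖ ≤ (√(hardyConst N p))⁻¹ * ‖φ‖ := by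
  have hC := hardyConst_pos hp hpN
  rw [inv_mul_eq_div, le_div_iff₀ (Real.sqrt_pos.2 hC)]
  refine le_of_sq_le_sq ?_ (norm_nonneg _)
  rw [mul_pow, Real.sq_sqrt hC.le, mul_comm]
  exact norm_massTest_le hp hpN φ

/-- The continuous extension of the inclusion into `L²(U^{p*-2} dx)` to `D_*^{1,2}(ℝ^N)`. -/
def massEmbedding (hp : 1 < p) (hpN : p < N) : DStar N p →L[ℝ] Lp ℝ 2 (massMeasure N p) :=
  (massTest hp hpN).extendOfNorm
    (UniformSpace.Completion.toComplL : TestFun N p →L[ℝ] DStar N p).toLinearMap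

/-- The extension agrees with the inclusion because test functions are dense and the Hardy
inequality bounds the inclusion. -/
lemma massEmbedding_toDStar (hp : 1 < p) (hpN : p < N) (φ : TestFun N p) :
    massEmbedding hp hpN φ.toDStar = massTest hp hpN φ :=
  LinearMap.extendOfNorm_eq (e := (UniformSpace.Completion.toComplL :
      TestFun N p →L[ℝ] DStar N p).toLinearMap) UniformSpace.Completion.denseRange_coe
    ⟨_, fun φ => (norm_massTest_le' hp hpN φ).trans_eq
      (by rw [← UniformSpace.Completion.norm_coe φ]; rfl)⟩ φ

lemma norm_massEmbedding_le (hp : 1 < p) (hpN : p < N) (Φ : DStar N p) :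
    hardyConst N p * ‖massEmbedding hp hpN Φ‖ ^ 2 ≤ ‖grad Φ‖ ^ 2 := by
  rw [norm_grad]
  induction Φ using UniformSpace.Completion.induction_on with
  | hp =>
    refine isClosed_le ?_ (continuous_norm.pow 2)
    exact continuous_const.mul ((massEmbedding hp hpN).continuous.norm.pow 2)
  | ih φ =>
    rw [UniformSpace.Completion.norm_coe]
    exact (congrArg (fun f => hardyConst N p * ‖f‖ ^ 2)
      (massEmbedding_toDStar hp hpN φ)).trans_le (norm_massTest_le hp hpN φ)

/-! ### Weak gradients off the origin and injectivity. -/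

/-- `(η/w) v` lies in `L²(w dx)`, `w = |∇U|^{p-2}`, when `η` is continuous with compact support
off the origin. -/
lemma memLp_smul_div_gradWeight (hp : 1 < p) (hpN : p < N) {η : Space N → ℝ} (hη : Continuous η)
    (hc : HasCompactSupport η) (h0 : tsupport η ⊆ {0}ᶜ) (v : Space N) :
    MemLp (fun x => (η x / gradWeight N p x) • v) 2 (gradMeasure N p) := by
  -- The weight may vanish or blow up at the origin, but the quotient is zero near it.
  have hcont : Continuous fun x => η x / gradWeight N p x := by
    refine ContinuousOn.continuous_of_tsupport_subset (s := {0}ᶜ) ?_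
      isOpen_compl_singleton (subset_trans ?_ h0)
    · intro x hx
      exact (hη.continuousAt.div (continuousAt_gradWeight hp hpN hx)
        (gradWeight_pos hp hpN hx).ne').continuousWithinAt
    · simp_rw [div_eq_mul_inv]
      exact tsupport_mul_subset_left
  have hm : AEStronglyMeasurable (fun x => (η x / gradWeight N p x) • v) (gradMeasure N p) :=
    (hcont.smul continuous_const).aestronglyMeasurable
  rw [memLp_two_iff_integrable_sq_norm hm, gradMeasure,
    integrable_withDensity_ofReal (measurable_gradWeight hp hpN) gradWeight_nonneg]
  have heq : (fun x => gradWeight N p x • ‖(η x / gradWeight N p x) • v‖ ^ 2) =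
      fun x => η x * ((η x / gradWeight N p x) * ‖v‖ ^ 2) := by
    funext x
    by_cases hx : gradWeight N p x = 0
    · simp [hx]
    · rw [norm_smul, mul_pow, Real.norm_eq_abs, sq_abs, smul_eq_mul]
      field_simp
  rw [heq]
  exact (hη.mul (hcont.mul continuous_const)).integrable_of_hasCompactSupport hc.mul_right

lemma gradMeasure_absolutelyContinuous :
    gradMeasure N p ≪ (volume : Measure (Space N)) :=
  withDensity_absolutelyContinuous _ _

/-- The weight cancels against the 1/w in the test field. The unweighted pairing is thereby a
continuous functional of G. -/
lemma inner_toLp_grad (hp : 1 < p) (hpN : p < N) {η : Space N → ℝ} (hη : Continuous η)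
    (hc : HasCompactSupport η) (h0 : tsupport η ⊆ {0}ᶜ) (v : Space N)
    (G : Lp (Space N) 2 (gradMeasure N p)) :
    inner ℝ ((memLp_smul_div_gradWeight hp hpN hη hc h0 v).toLp _) G =
      ∫ x, η x * inner ℝ v (G x) := by
  rw [L2.inner_def]
  have h : ∀ᵐ x ∂gradMeasure N p,
      inner ℝ ((memLp_smul_div_gradWeight hp hpN hη hc h0 v).toLp _ x) (G x) =
        (η x / gradWeight N p x) * inner ℝ v (G x) := by
    filter_upwards [(memLp_smul_div_gradWeight hp hpN hη hc h0 v).coeFn_toLp] with x hx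
    rw [hx, real_inner_smul_left]
  refine (integral_congr_ae h).trans ((integral_withDensity_ofReal (measurable_gradWeight hp hpN)
    gradWeight_nonneg _).trans (integral_congr_ae ?_))
  filter_upwards [ae_ne_zero hp hpN] with x hx
  have := (gradWeight_pos hp hpN hx).ne'
  rw [smul_eq_mul]
  field_simp

lemma memLp_div_massWeight (hp : 1 < p) (hpN : p < N) {η : Space N → ℝ} (hη : Continuous η)
    (hc : HasCompactSupport η) :
    MemLp (fun x => η x / massWeight N p x) 2 (massMeasure N p) := by
  refine memLp_massMeasure hp hpN
    (hη.div (continuous_massWeight hp hpN) fun x => (massWeight_pos hp hpN x).ne') ?_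
  simp_rw [div_eq_mul_inv]
  exact hc.mul_right

lemma inner_toLp_mass (hp : 1 < p) (hpN : p < N) {η : Space N → ℝ} (hη : Continuous η)
    (hc : HasCompactSupport η) {f : Lp ℝ 2 (massMeasure N p)} {g : Space N → ℝ}
    (hfg : f =ᵐ[massMeasure N p] g) :
    inner ℝ ((memLp_div_massWeight hp hpN hη hc).toLp _) f = ∫ x, η x * g x := by
  rw [L2.inner_def]
  have h : ∀ᵐ x ∂massMeasure N p,
      inner ℝ ((memLp_div_massWeight hp hpN hη hc).toLp _ x) (f x) =
        (η x / massWeight N p x) * g x := by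
    filter_upwards [(memLp_div_massWeight hp hpN hη hc).coeFn_toLp, hfg] with x hx hx'
    rw [hx, hx']
    simp [mul_comm]
  refine (integral_congr_ae h).trans ((integral_withDensity_ofReal
    (continuous_massWeight hp hpN).measurable (fun x => (massWeight_pos hp hpN x).le) _).trans
    (integral_congr_ae (ae_of_all _ fun x => ?_)))
  have := (massWeight_pos hp hpN x).ne'
  simp only [smul_eq_mul]
  field_simp

/-- Integration by parts in `D_*^{1,2}(ℝ^N)`, against functions supported off the origin. -/
lemma inner_grad_eq (hp : 1 < p) (hpN : p < N) {η : Space N → ℝ} (hη : ContDiff ℝ 1 η)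
    (hc : HasCompactSupport η) (h0 : tsupport η ⊆ {0}ᶜ) (v : Space N) (Φ : DStar N p) :
    inner ℝ ((memLp_smul_div_gradWeight hp hpN hη.continuous hc h0 v).toLp _) (grad Φ) =
      -inner ℝ ((memLp_div_massWeight hp hpN (η := fun x => fderiv ℝ η x v)
        ((hη.continuous_fderiv one_ne_zero).clm_apply continuous_const)
        (hc.fderiv_apply ℝ v)).toLp _) (massEmbedding hp hpN Φ) := by
  induction Φ using UniformSpace.Completion.induction_on with
  | hp =>
    -- Both sides are inner products with fixed vectors, hence continuous in Φ; only test functions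
    -- remain.
    refine isClosed_eq (continuous_const.inner UniformSpace.Completion.continuous_extension)
      (continuous_const.inner (massEmbedding hp hpN).continuous).neg
  | ih φ =>
    have hφ := φ.contDiff
    have hφc := φ.hasCompactSupport
    have hg : grad (φ : DStar N p) = gradTest N p φ := grad_toDStar φ
    have hm : massEmbedding hp hpN (φ : DStar N p) = massTest hp hpN φ :=
      massEmbedding_toDStar hp hpN φ
    rw [hg, hm, inner_toLp_grad hp hpN hη.continuous hc h0,
      inner_toLp_mass hp hpN ((hη.continuous_fderiv one_ne_zero).clm_apply continuous_const)
        (hc.fderiv_apply ℝ v) (coeFn_massTest hp hpN φ)]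
    have hgrad : ∀ᵐ x : Space N, η x * inner ℝ v (gradTest N p φ x) =
        η x * fderiv ℝ φ.toFun x v := by
      have h1 : ∀ᵐ x ∂gradMeasure N p, gradTest N p φ x = gradient φ.toFun x :=
        φ.memLp_gradient.coeFn_toLp
      have h2 := (ae_withDensity_iff (measurable_gradWeight hp hpN).ennreal_ofReal).1 h1
      filter_upwards [h2, ae_ne_zero hp hpN] with x hx hx0
      rw [hx (by simpa using gradWeight_pos hp hpN hx0), real_inner_comm]
      simp [gradient]
    rw [integral_congr_ae hgrad]
    have hdη := hη.continuous_fderiv one_ne_zero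
    have hdφ := hφ.continuous_fderiv one_ne_zero
    have hφ' := hφ.continuous
    have hη' := hη.continuous
    refine integral_mul_fderiv_eq_neg_fderiv_mul_of_integrable ?_ ?_ ?_
      (fun x _ => hη.differentiable one_ne_zero x) (fun x _ => hφ.differentiable one_ne_zero x)
    · exact Continuous.integrable_of_hasCompactSupport (by fun_prop) hφc.mul_left
    · exact Continuous.integrable_of_hasCompactSupport (by fun_prop) hc.mul_right
    · exact Continuous.integrable_of_hasCompactSupport (by fun_prop) hc.mul_right

/-- Young's inequality gives |G| ≤ w⁻¹ + w|G|², where w⁻¹ is continuous on compact sets avoiding the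
origin and w|G|² is integrable. -/
lemma locallyIntegrableOn_of_memLp_gradMeasure (hp : 1 < p) (hpN : p < N)
    (G : Lp (Space N) 2 (gradMeasure N p)) :
    LocallyIntegrableOn (fun x => G x) {0}ᶜ (volume : Measure (Space N)) := by
  rw [locallyIntegrableOn_iff isOpen_compl_singleton.isLocallyClosed]
  intro K hK hKc
  have hGm : StronglyMeasurable (fun x => G x) := Lp.stronglyMeasurable G
  have hcont : ContinuousOn (fun x => (gradWeight N p x)⁻¹) K := fun x hx =>
    ((continuousAt_gradWeight hp hpN (hK hx)).inv₀
      (gradWeight_pos hp hpN (hK hx)).ne').continuousWithinAt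
  have h1 : IntegrableOn (fun x => (gradWeight N p x)⁻¹) K := hcont.integrableOn_compact hKc
  have h2 : IntegrableOn (fun x => gradWeight N p x * ‖G x‖ ^ 2) K :=
    (integrable_weight_mul_norm_sq (measurable_gradWeight hp hpN) gradWeight_nonneg
      (Lp.memLp G)).integrableOn
  refine (h1.add h2).mono' hGm.aestronglyMeasurable ?_
  filter_upwards [ae_restrict_mem hKc.measurableSet] with x hx
  have hw := gradWeight_pos hp hpN (hK hx)
  simp only [Pi.add_apply]
  have h : 0 ≤ (gradWeight N p x)⁻¹ * ((gradWeight N p x * ‖G x‖ - 1) ^ 2 +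
      gradWeight N p x * ‖G x‖) := by positivity
  have h' : (gradWeight N p x)⁻¹ * ((gradWeight N p x * ‖G x‖ - 1) ^ 2 +
      gradWeight N p x * ‖G x‖) =
      (gradWeight N p x)⁻¹ + gradWeight N p x * ‖G x‖ ^ 2 - ‖G x‖ := by
    field_simp
    ring
  linarith

lemma massEmbedding_injective (hp : 1 < p) (hpN : p < N) :
    Function.Injective (massEmbedding hp hpN) := by
  rw [injective_iff_map_eq_zero]
  intro Φ hΦ
  have hloc := locallyIntegrableOn_of_memLp_gradMeasure hp hpN (grad Φ)
  have hae : ∀ᵐ x : Space N, x ∈ ({0}ᶜ : Set (Space N)) → grad Φ x = 0 := by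
    refine isOpen_compl_singleton.ae_eq_zero_of_integral_contDiff_smul_eq_zero hloc ?_
    intro η hη hc h0
    have hη1 : ContDiff ℝ 1 η := hη.of_le (by exact_mod_cast le_top)
    have hint : Integrable fun x => η x • grad Φ x := by
      refine (integrableOn_iff_integrable_of_support_subset (s := tsupport η) ?_).1 ?_
      · exact fun x hx => subset_tsupport _ (Function.support_smul_subset_left _ _ hx)
      · exact (hloc.integrableOn_compact_subset h0 hc).continuousOn_smul
          hη.continuous.continuousOn hc
    -- The vector integral is tested against each v, where the zero image makes the
    -- integrated-by-parts side vanish.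
    refine ext_inner_left ℝ fun v => ?_
    have h := inner_grad_eq hp hpN hη1 hc h0 v Φ
    rw [hΦ, inner_zero_right, neg_zero, inner_toLp_grad hp hpN hη.continuous hc h0] at h
    rw [← integral_inner hint, inner_zero_right, ← h]
    simp [real_inner_smul_right]
  have hG : grad Φ = 0 := by
    rw [Lp.eq_zero_iff_ae_eq_zero]
    refine gradMeasure_absolutelyContinuous.ae_le ?_
    filter_upwards [hae, ae_ne_zero hp hpN] with x hx hx0 using hx hx0
  rw [← norm_eq_zero, ← norm_grad, hG, norm_zero]

end CriticalBubble
end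

theorem proposition2p2 (N : ℕ) (p : ℝ) (hp : 1 < p) (hpN : p < (N : ℝ)) :
    ∃ C : ℝ, 0 < C ∧
      ∃ ι : CriticalBubble.DStar N p →L[ℝ]
          MeasureTheory.Lp ℝ 2 (CriticalBubble.massMeasure N p),
        Function.Injective ι ∧
        (∀ φ : CriticalBubble.TestFun N p,
          ∀ᵐ x ∂(MeasureTheory.volume : MeasureTheory.Measure (CriticalBubble.Space N)),
            ι φ.toDStar x = φ.toFun x) ∧
        ∀ Φ : CriticalBubble.DStar N p,
          ENNReal.ofReal C *
              ∫⁻ x, ENNReal.ofReal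
                (CriticalBubble.bubble N p x ^ (CriticalBubble.critExp N p - 2) * (ι Φ x) ^ 2) ≤
            ∫⁻ x, ENNReal.ofReal
              (‖gradient (CriticalBubble.bubble N p) x‖ ^ (p - 2) *
                ‖CriticalBubble.grad Φ x‖ ^ 2) := by
  open CriticalBubble in
  refine ⟨hardyConst N p, hardyConst_pos hp hpN, massEmbedding hp hpN,
    massEmbedding_injective hp hpN, fun φ => ?_, fun Φ => ?_⟩
  · rw [massEmbedding_toDStar]
    -- The mass weight is positive everywhere, so its null sets are Lebesgue null.
    refine (withDensity_absolutelyContinuous'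
      (continuous_massWeight hp hpN).measurable.ennreal_ofReal.aemeasurable
      (ae_of_all _ fun x => ?_)).ae_le (coeFn_massTest hp hpN φ)
    simpa using massWeight_pos hp hpN x
  · have h1 := ofReal_norm_sq_eq_lintegral (continuous_massWeight hp hpN).measurable
      (fun x => (massWeight_pos hp hpN x).le) (massEmbedding hp hpN Φ)
    have h2 := ofReal_norm_sq_eq_lintegral (measurable_gradWeight hp hpN) gradWeight_nonneg (grad Φ)
    simp only [Real.norm_eq_abs, sq_abs] at h1
    refine (congrArg _ h1.symm).trans_le (le_trans ?_ h2.le)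
    rw [← ENNReal.ofReal_mul (hardyConst_pos hp hpN).le]
    exact ENNReal.ofReal_le_ofReal (norm_massEmbedding_le hp hpN Φ)
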